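/- Graphs are simple and undirected, with nonempty vertex set unless they belong to $\mathcal C$; "countable" means finite or countably infinite, and graphs are regarded as first-order structures in the language with one binary relation symbol for adjacency. Let $\mathcal C$ be a finite set of finite graphs. A graph is $\mathcal C$-free if none of its (not necessarily induced) subgraphs is isomorphic to a member of $\mathcal C$; let $\mathcal G_{\mathcal C}$ be the class of countable $\mathcal C$-free graphs, and $T_{\mathcal C}$ its first-order theory, i.e. the set of sentences true in all members of $\mathcal G_{\mathcal C}$. A graph $G\in\mathcal G_{\mathcal C}$ is existentially complete if for every $H\in\mathcal G_{\mathcal C}$ containing $G$ as an induced subgraph, every existential formula with parameters from $G$ that is true in $H$ is true in $G$. Let $\mathcal E_{\mathcal C}$ be the class of existentially complete graphs in $\mathcal G_{\mathcal C}$, and $T^*_{\mathcal C}$ the first-order theory of $\mathcal E_{\mathcal C}$. Then: 1. $\mathcal E_{\mathcal C}$ is exactly the class of countable models of $T^*_{\mathcal C}$. 2. If every graph in $\mathcal C$ is connected and has at least two vertices, then $T^*_{\mathcal C}$ is complete (that is, it is consistent, and for every sentence $\varphi$ it entails $\varphi$ or $\neg\varphi$). 3. $T^*_{\mathcal C}$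 is model complete (every embedding between models of $T^*_{\mathcal C}$ is elementary), and it is the model companion of $T_{\mathcal C}$ (moreover, every model of $T_{\mathcal C}$ embeds in a model of $T^*_{\mathcal C}$ and every model of $T^*_{\mathcal C}$ embeds in a model of $T_{\mathcal C}$). -/

import Mathlib

open FirstOrder

universe u w

namespace ForbiddenSubgraphs

/-- A finite graph (simple, undirected), together with its vertex set. -/
structure FiniteGraph where
  V : Type
  [finite : Finite V]
  graph : SimpleGraph V

/-- `G` is `𝒞`-free: no (not necessarily induced) subgraph of `G` is isomorphic to a graph
in `𝒞`. -/
def Omits (𝒞 : Set FiniteGraph) {V : Type u} (G : SimpleGraph V) : Prop :=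
  ∀ C ∈ 𝒞, C.graph.Free G

/-- `G` is a countable (finite or countably infinite) `𝒞`-free graph. As usual in model theory,
structures are nonempty. -/
structure IsCountableFree (𝒞 : Set FiniteGraph) {V : Type u} (G : SimpleGraph V) : Prop where
  nonempty : Nonempty V
  countable : Countable V
  omits : Omits 𝒞 G

/-- `G` is existentially complete in `H`, where `G` is regarded as an induced subgraph of `H`
through `f`: every existential statement with parameters from `G` which is true in `H` is true
in `G`. -/
def IsExistentiallyCompleteIn {V : Type u} {W : Type w} {G : SimpleGraph V} {H : SimpleGraph W}
    (f : G ↪g H) : Prop :=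
  ∀ (n : ℕ) (φ : Language.graph.Formula (Fin n)),
    Language.BoundedFormula.IsExistential φ → ∀ v : Fin n → V,
      @Language.Formula.Realize Language.graph W H.structure (Fin n) φ (f ∘ v) →
      @Language.Formula.Realize Language.graph V G.structure (Fin n) φ v

/-- `G` is a countable existentially complete `𝒞`-free graph. The extensions are countable, so
nothing is lost by taking their vertex sets in the lowest universe. -/
structure IsExistentiallyComplete (𝒞 : Set FiniteGraph) {V : Type u} (G : SimpleGraph V) :
    Prop where
  countableFree : IsCountableFree 𝒞 G
  complete_in : ∀ (W : Type) (H : SimpleGraph W), IsCountableFree 𝒞 H →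
    ∀ f : G ↪g H, IsExistentiallyCompleteIn f

/-- The first-order theory of the class of countable `𝒞`-free graphs. -/
def freeTheory (𝒞 : Set FiniteGraph) : Language.graph.Theory :=
  {φ | ∀ (V : Type) (G : SimpleGraph V), IsCountableFree 𝒞 G →
    @Language.Sentence.Realize Language.graph V G.structure φ}

/-- The first-order theory of the class of countable existentially complete `𝒞`-free graphs. -/
def existentiallyCompleteTheory (𝒞 : Set FiniteGraph) : Language.graph.Theory :=
  {φ | ∀ (V : Type) (G : SimpleGraph V), IsExistentiallyComplete 𝒞 G →
    @Language.Sentence.Realize Language.graph V G.structure φ}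

/-- A theory is model complete if every embedding between models of it is elementary. -/
def IsModelComplete {L : FirstOrder.Language.{0, 0}} (T : L.Theory) : Prop :=
  ∀ (M N : Type w) [L.Structure M] [L.Structure N] [Nonempty M] [Nonempty N],
    Language.Theory.Model M T → Language.Theory.Model N T → ∀ f : M ↪[L] N,
      ∀ (n : ℕ) (φ : L.Formula (Fin n)) (v : Fin n → M),
        φ.Realize (f ∘ v) ↔ φ.Realize v

/-- Every model of `T` embeds in a model of `T'`. -/
def ModelsEmbed {L : FirstOrder.Language.{0, 0}} (T T' : L.Theory) : Prop :=
  ∀ (M : Type w) [L.Structure M] [Nonempty M], Language.Theory.Model M T →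
    ∃ (N : Type w) (_ : L.Structure N), Nonempty N ∧ Language.Theory.Model N T' ∧
      Nonempty (M ↪[L] N)

/-- `T'` is a model companion of `T`: it is model complete, and each model of one of the two
theories embeds in a model of the other. -/
structure IsModelCompanion {L : FirstOrder.Language.{0, 0}} (T' T : L.Theory) : Prop where
  modelComplete : IsModelComplete.{w} T'
  embed : ModelsEmbed.{w} T T'
  embed' : ModelsEmbed.{w} T' T

end ForbiddenSubgraphs

/-! The heart of the proof is a first-order axiomatization of existential completeness. Suppose that
new vertices of a `𝒞`-free extension `H` of `G` realize a finite graph `A` over a tuple `a` of `G`.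
The free amalgam `glue G a A` has only the edges that `G` and `A` demand, so it is a subgraph of `H`
(`glue_isContained`) and is `𝒞`-free too. Hence `A` is realizable by new vertices exactly when this
one amalgam is `𝒞`-free. Since `𝒞` is a finite set of finite graphs, the failure of this is an
existential condition on `a` (`realize_forbiddenFormula`), so `extensionSentence` is first-order.
Existentially complete graphs satisfy it (`extensionSentence_mem`); conversely, it lets any finite
piece of a `𝒞`-free extension be copied back into `G` over `G` (`exists_partial_embedding`), so
models of any cardinality are existentially complete.

Existentially complete graphs over a given finite graph come from a generic chain of finite graphs
(`exists_isExistentiallyComplete`). Ultraproducts of them receive every `𝒞`-free graph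
(`exists_model_of_omits`), and an extension of a model `M` embeds over `M` in an ultrapower of `M`
(`exists_elementary_extension`); model completeness follows by induction on formulas. If the members
of `𝒞` are connected, disjoint unions of `𝒞`-free graphs are `𝒞`-free, so any two models embed in a
third and are elementarily equivalent. -/

namespace ForbiddenSubgraphs

/-! ### Quantifier-free descriptions of finite tuples -/

section Formulas

open Language Structure

variable {L : Language} {α β : Type*} {n : ℕ}

theorem isQF_foldr_sup {l : List (L.BoundedFormula α n)} (h : ∀ φ ∈ l, φ.IsQF) :
    (l.foldr (· ⊔ ·) ⊥).IsQF := by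
  induction l with
  | nil => exact BoundedFormula.isQF_bot
  | cons φ l ih =>
    exact (h φ (by simp)).sup (ih fun ψ hψ => h ψ (by simp [hψ]))

theorem isQF_foldr_inf {l : List (L.BoundedFormula α n)} (h : ∀ φ ∈ l, φ.IsQF) :
    (l.foldr (· ⊓ ·) ⊤).IsQF := by
  induction l with
  | nil => exact BoundedFormula.IsQF.top
  | cons φ l ih =>
    exact (h φ (by simp)).inf (ih fun ψ hψ => h ψ (by simp [hψ]))

theorem isQF_iSup [Finite β] {f : β → L.Formula α} (h : ∀ b, (f b).IsQF) :
    (Formula.iSup f).IsQF := by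
  refine isQF_foldr_sup fun φ hφ => ?_
  obtain ⟨b, -, rfl⟩ := List.mem_map.1 hφ
  exact h b

theorem isQF_iInf [Finite β] {f : β → L.Formula α} (h : ∀ b, (f b).IsQF) :
    (Formula.iInf f).IsQF := by
  refine isQF_foldr_inf fun φ hφ => ?_
  obtain ⟨b, -, rfl⟩ := List.mem_map.1 hφ
  exact h b

theorem isExistential_exs {φ : L.BoundedFormula α n} (h : φ.IsExistential) :
    BoundedFormula.IsExistential φ.exs := by
  induction n with
  | zero => exact h
  | succ n ih => exact ih h.ex

theorem isExistential_iExs [Finite β] {φ : L.Formula (α ⊕ β)} (h : φ.IsQF) :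
    BoundedFormula.IsExistential (φ.iExs β) :=
  isExistential_exs (h.relabel _).isExistential

open Classical in
/-- The literal `φ` or `¬ φ`, according to the truth value `p`. -/
noncomputable def literal (p : Prop) (φ : L.Formula α) : L.Formula α :=
  if p then φ else φ.not

theorem realize_literal {M : Type*} [L.Structure M] {p : Prop} {φ : L.Formula α} {v : α → M} :
    (literal p φ).Realize v ↔ (φ.Realize v ↔ p) := by
  unfold literal
  split_ifs with h <;> simp [h, Formula.realize_not]

theorem isQF_literal {p : Prop} {φ : L.Formula α} (h : φ.IsQF) : (literal p φ).IsQF := by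
  unfold literal
  split_ifs
  exacts [h, h.not]

/-- A formula expressing a given property of the equality type and adjacency type of a finite
tuple of vertices. -/
noncomputable def patternFormula [Finite α]
    (Q : (α → α → Prop) → (α → α → Prop) → Prop) : Language.graph.Formula α :=
  Formula.iSup fun p : {p : (α → α → Prop) × (α → α → Prop) // Q p.1 p.2} =>
    Formula.iInf fun i : α × α =>
      literal (p.1.1 i.1 i.2) ((Term.var i.1).equal (Term.var i.2)) ⊓
        literal (p.1.2 i.1 i.2) (adj.formula₂ (Term.var i.1) (Term.var i.2))

theorem isQF_patternFormula [Finite α] (Q : (α → α → Prop) → (α → α → Prop) → Prop) :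
    (patternFormula Q).IsQF := by
  refine isQF_iSup fun p => isQF_iInf fun i => (isQF_literal ?_).inf (isQF_literal ?_)
  · exact .of_isAtomic (.equal _ _)
  · exact .of_isAtomic (.rel _ _)

theorem realize_patternFormula [Finite α] {Q : (α → α → Prop) → (α → α → Prop) → Prop}
    {V : Type*} (G : SimpleGraph V) {v : α → V} :
    @Formula.Realize _ V G.structure _ (patternFormula Q) v ↔
      Q (fun i j => v i = v j) (fun i j => G.Adj (v i) (v j)) := by
  let := G.structure
  have hadj (i j : α) : (adj.formula₂ (Term.var i) (Term.var j)).Realize v ↔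
      G.Adj (v i) (v j) := by
    rw [Formula.realize_rel₂]
    rfl
  simp only [patternFormula, Formula.realize_iSup, Formula.realize_iInf, Formula.realize_inf,
    realize_literal, Formula.realize_equal, hadj, Term.realize_var]
  constructor
  · rintro ⟨⟨⟨e, r⟩, hQ⟩, h⟩
    have he : (fun i j => v i = v j) = e := by
      ext i j; exact (h (i, j)).1
    have hr : (fun i j => G.Adj (v i) (v j)) = r := by
      ext i j; exact (h (i, j)).2
    rwa [he, hr]
  · exact fun hQ => ⟨⟨⟨_, _⟩, hQ⟩, fun _ => ⟨Iff.rfl, Iff.rfl⟩⟩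

end Formulas

/-! ### Existential formulas and induced subgraphs -/

section Embeddings

open Language

variable {V : Type*} {W : Type*} {G : SimpleGraph V} {H : SimpleGraph W}

/-- Induced subgraphs are substructures. -/
def languageEmbedding (f : G ↪g H) :
    @Language.Embedding Language.graph V W G.structure H.structure :=
  letI := G.structure
  letI := H.structure
  { f.toEmbedding with
    map_fun' := fun F => isEmptyElim F
    map_rel' := fun {_} r x => by
      cases r
      exact f.map_adj_iff }

/-- Substructures are induced subgraphs. -/
def graphEmbedding (f : @Language.Embedding Language.graph V W G.structure H.structure) :
    G ↪g H :=
  letI := G.structure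
  letI := H.structure
  { f.toEmbedding with
    map_rel_iff' := fun {a b} => f.map_rel' adj ![a, b] }

theorem realize_of_graphEmbedding {α : Type*} {n : ℕ} {φ : Language.graph.BoundedFormula α n}
    (hφ : φ.IsExistential) (f : G ↪g H) {v : α → V} {xs : Fin n → V}
    (h : @BoundedFormula.Realize _ V G.structure _ _ φ v xs) :
    @BoundedFormula.Realize _ W H.structure _ _ φ (f ∘ v) (f ∘ xs) := by
  let := G.structure
  let := H.structure
  exact hφ.realize_embedding (languageEmbedding f) h

theorem formula_realize_of_graphEmbedding {α : Type*} {φ : Language.graph.Formula α}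
    (hφ : BoundedFormula.IsExistential φ) (f : G ↪g H) {v : α → V}
    (h : @Formula.Realize _ V G.structure _ φ v) :
    @Formula.Realize _ W H.structure _ φ (f ∘ v) := by
  have := realize_of_graphEmbedding hφ f h
  rwa [Subsingleton.elim (f ∘ default) default] at this

theorem sentence_realize_of_iso (e : G ≃g H) (φ : Language.graph.Sentence) :
    @Sentence.Realize _ V G.structure φ ↔ @Sentence.Realize _ W H.structure φ := by
  let := G.structure
  let := H.structure
  let e' : V ≃[Language.graph] W :=
    { e.toEquiv with
      map_fun' := fun F => isEmptyElim F
      map_rel' := (languageEmbedding e.toEmbedding).map_rel' }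
  exact StrongHomClass.realize_sentence e' φ

/-- An existential formula true in a graph is true in some finite induced subgraph. -/
theorem exists_finite_realize {α : Type*} [Finite α] {n : ℕ}
    {φ : Language.graph.BoundedFormula α n} (hφ : φ.IsExistential) {v : α → W} {xs : Fin n → W}
    (h : @BoundedFormula.Realize _ W H.structure _ _ φ v xs) :
    ∃ s : Set W, s.Finite ∧ ∃ (v' : α → s) (xs' : Fin n → s), (∀ i, (v' i : W) = v i) ∧
      (∀ i, (xs' i : W) = xs i) ∧
      @BoundedFormula.Realize _ s (H.induce s).structure _ _ φ v' xs' := by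
  let := H.structure
  induction hφ with
  | of_isQF hQF =>
    refine ⟨Set.range v ∪ Set.range xs, (Set.finite_range v).union (Set.finite_range xs),
      fun i => ⟨v i, .inl ⟨i, rfl⟩⟩, fun i => ⟨xs i, .inr ⟨i, rfl⟩⟩, fun _ => rfl, fun _ => rfl, ?_⟩
    let := (H.induce (Set.range v ∪ Set.range xs)).structure
    exact (hQF.realize_embedding
      (languageEmbedding (SimpleGraph.Embedding.induce (G := H) _))).1 h
  | @ex n φ hφ ih =>
    obtain ⟨b, hb⟩ := BoundedFormula.realize_ex.1 h
    obtain ⟨s, hs, v', xs', hv, hxs, h'⟩ := ih hb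
    refine ⟨s, hs, v', fun i => xs' i.castSucc, hv, fun i => by simp [hxs], ?_⟩
    let := (H.induce s).structure
    refine BoundedFormula.realize_ex.2 ⟨xs' (Fin.last n), ?_⟩
    convert h' using 1
    ext i
    refine Fin.lastCases ?_ (fun i => ?_) i <;> simp

end Embeddings

/-! ### Heredity and finite character of `𝒞`-freeness -/

theorem Omits.of_isContained {𝒞 : Set FiniteGraph} {V : Type*} {W : Type*} {G : SimpleGraph V}
    {H : SimpleGraph W} (hH : Omits 𝒞 H) (h : G.IsContained H) : Omits 𝒞 G :=
  fun C hC hCG => hH C hC (hCG.trans h)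

theorem Omits.of_embedding {𝒞 : Set FiniteGraph} {V : Type*} {W : Type*} {G : SimpleGraph V}
    {H : SimpleGraph W} (hH : Omits 𝒞 H) (f : G ↪g H) : Omits 𝒞 G :=
  hH.of_isContained f.isContained

/-- Freeness of forbidden subgraphs is a property of the finite induced subgraphs. -/
theorem omits_of_finite {𝒞 : Set FiniteGraph} {V : Type*} {G : SimpleGraph V}
    (h : ∀ s : Set V, s.Finite → Omits 𝒞 (G.induce s)) : Omits 𝒞 G := by
  rintro C hC ⟨f⟩
  have := C.finite
  refine h (Set.range f) (Set.finite_range f) C hC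
    ⟨⟨⟨fun x => ⟨f x, x, rfl⟩, fun hxy => f.toHom.map_adj hxy⟩, fun x y hxy => ?_⟩⟩
  exact f.injective (congrArg Subtype.val hxy)

/-! ### Free amalgams with a finite graph -/

section Glue

variable {V : Type*} {n m : ℕ}

/-- The free amalgam of `G` and of the finite graph `A`, over the vertices `a` of `G`. -/
def glue (G : SimpleGraph V) (a : Fin n → V) (A : SimpleGraph (Fin n ⊕ Fin m)) :
    SimpleGraph (V ⊕ Fin m) where
  Adj
    | .inl x, .inl y => G.Adj x y
    | .inl x, .inr j => ∃ i, a i = x ∧ A.Adj (.inl i) (.inr j)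
    | .inr j, .inl x => ∃ i, a i = x ∧ A.Adj (.inl i) (.inr j)
    | .inr i, .inr j => A.Adj (.inr i) (.inr j)
  symm := ⟨by
    rintro (x | i) (y | j) h
    exacts [SimpleGraph.Adj.symm h, h, h, SimpleGraph.Adj.symm h]⟩
  loopless := ⟨by
    rintro (x | i) h
    exacts [G.loopless.irrefl _ h, A.loopless.irrefl _ h]⟩

variable {G : SimpleGraph V} {a : Fin n → V} {A : SimpleGraph (Fin n ⊕ Fin m)}

/-- A graph is an induced subgraph of its free amalgams. -/
def glueInl (G : SimpleGraph V) (a : Fin n → V) (A : SimpleGraph (Fin n ⊕ Fin m)) :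
    G ↪g glue G a A where
  toFun := Sum.inl
  inj' := Sum.inl_injective
  map_rel_iff' := Iff.rfl

theorem glue_adj_iff (hinj : Function.Injective a)
    (hA : ∀ i j, G.Adj (a i) (a j) ↔ A.Adj (.inl i) (.inl j)) (x y : Fin n ⊕ Fin m) :
    (glue G a A).Adj (Sum.map a id x) (Sum.map a id y) ↔ A.Adj x y := by
  rcases x with i | i <;> rcases y with j | j
  · exact hA i j
  · refine ⟨fun ⟨k, hk, h⟩ => hinj hk ▸ h, fun h => ⟨i, rfl, h⟩⟩
  · exact ⟨fun ⟨k, hk, h⟩ => (hinj hk ▸ h).symm, fun h => ⟨j, rfl, h.symm⟩⟩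
  · exact Iff.rfl

/-- If `A` extends the graph induced by `a` inside an extension `H` of `G`, with the new vertices
outside `G`, then the free amalgam is a subgraph of `H`. -/
theorem glue_isContained {W : Type*} {H : SimpleGraph W} (f : G ↪g H) {b : Fin m → W}
    (hb : Function.Injective b) (hbf : ∀ j v, f v ≠ b j)
    (hA : ∀ x y, A.Adj x y → H.Adj (Sum.elim (f ∘ a) b x) (Sum.elim (f ∘ a) b y)) :
    (glue G a A).IsContained H := by
  refine ⟨⟨⟨Sum.elim f b, ?_⟩, ?_⟩⟩
  · rintro (x | i) (y | j) h
    · exact f.map_adj_iff.2 h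
    · obtain ⟨k, rfl, h⟩ := h
      exact hA _ _ h
    · obtain ⟨k, rfl, h⟩ := h
      exact (hA _ _ h).symm
    · exact hA _ _ h
  · exact f.injective.sumElim hb fun v j => hbf j v

/-- The map to `V ⊕ Fin m` given by `c`, except where `r` prescribes a value in `Fin m`. -/
def place {X : Type*} (r : X → Option (Fin m)) (c : X → V) (x : X) : V ⊕ Fin m :=
  (r x).elim (.inl (c x)) .inr

theorem exists_place {X : Type*} [Nonempty V] (h : X → V ⊕ Fin m) :
    ∃ r c, place r c = h := by
  -- Where `r` prescribes a new vertex the value of `c` is never read, so any default serves.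
  refine ⟨fun x => (h x).getRight?, fun x => (h x).elim id fun _ => Classical.arbitrary V, ?_⟩
  ext1 x
  rcases hx : h x <;> simp [place, hx]

/-- The condition on the equality and adjacency types of vertices `a` and `c` which says that
`place r c` is a copy of `C` in the free amalgam over `a`. -/
def CopyPattern {X : Type*} (C : SimpleGraph X) (A : SimpleGraph (Fin n ⊕ Fin m))
    (r : X → Option (Fin m)) (e s : Fin n ⊕ X → Fin n ⊕ X → Prop) : Prop :=
  ∀ x y, match r x, r y with
    | none, none => (e (.inr x) (.inr y) → x = y) ∧ (C.Adj x y → s (.inr x) (.inr y))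
    | none, some j => C.Adj x y → ∃ i, e (.inl i) (.inr x) ∧ A.Adj (.inl i) (.inr j)
    | some j, none => C.Adj x y → ∃ i, e (.inl i) (.inr y) ∧ A.Adj (.inl i) (.inr j)
    | some i, some j => (i = j → x = y) ∧ (C.Adj x y → A.Adj (.inr i) (.inr j))

/-- An old vertex is joined to a new one only if it is an entry of `a`. Once `r` fixes which
vertices of `C` are new, being a copy of `C` therefore depends only on equalities and adjacencies
among `a` and `c`, all inside `G`. -/
theorem copyPattern_iff {X : Type*} {C : SimpleGraph X} {r : X → Option (Fin m)} {c : X → V} :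
    CopyPattern C A r (fun i j => Sum.elim a c i = Sum.elim a c j)
        (fun i j => G.Adj (Sum.elim a c i) (Sum.elim a c j)) ↔
      Function.Injective (place r c) ∧
        ∀ x y, C.Adj x y → (glue G a A).Adj (place r c x) (place r c y) := by
  have key : ∀ x y, (match r x, r y with
      | none, none => (c x = c y → x = y) ∧ (C.Adj x y → G.Adj (c x) (c y))
      | none, some j => C.Adj x y → ∃ i, a i = c x ∧ A.Adj (.inl i) (.inr j)
      | some j, none => C.Adj x y → ∃ i, a i = c y ∧ A.Adj (.inl i) (.inr j)
      | some i, some j => (i = j → x = y) ∧ (C.Adj x y → A.Adj (.inr i) (.inr j))) ↔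
      (place r c x = place r c y → x = y) ∧
        (C.Adj x y → (glue G a A).Adj (place r c x) (place r c y)) := by
    intro x y
    unfold place
    rcases r x with _ | i <;> rcases r y with _ | j <;> simp [glue]
  exact (forall₂_congr key).trans
    ⟨fun h => ⟨fun x y => (h x y).1, fun x y => (h x y).2⟩, fun h x y => ⟨@h.1 x y, h.2 x y⟩⟩

end Glue

/-! ### The extension axioms -/

section Axioms

open Language

variable {n m : ℕ}

/-- The existential formula which says that the free amalgam with `A` over a tuple contains a
member of `𝒞`. -/
noncomputable def forbiddenFormula (𝒞 : Set FiniteGraph) [Finite 𝒞]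
    (A : SimpleGraph (Fin n ⊕ Fin m)) : Language.graph.Formula (Fin n) :=
  Formula.iSup fun C : 𝒞 =>
    haveI := C.1.finite
    Formula.iSup fun r : C.1.V → Option (Fin m) =>
      (patternFormula (CopyPattern C.1.graph A r)).iExs C.1.V

/-- A copy of `C` in the amalgam splits into a placement `r` among the new vertices, of which there
are finitely many, and a map `c` into `V`, which can be quantified in `G`. -/
theorem realize_forbiddenFormula {𝒞 : Set FiniteGraph} [Finite 𝒞]
    {A : SimpleGraph (Fin n ⊕ Fin m)} {V : Type*} [Nonempty V] {G : SimpleGraph V}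
    {a : Fin n → V} :
    @Formula.Realize _ V G.structure _ (forbiddenFormula 𝒞 A) a ↔ ¬ Omits 𝒞 (glue G a A) := by
  let := G.structure
  simp only [forbiddenFormula, Formula.realize_iSup]
  have key (C : 𝒞) (r : C.1.V → Option (Fin m)) :
      haveI := C.1.finite
      ((patternFormula (CopyPattern C.1.graph A r)).iExs C.1.V).Realize a ↔
        ∃ c : C.1.V → V, Function.Injective (place r c) ∧
          ∀ x y, C.1.graph.Adj x y → (glue G a A).Adj (place r c x) (place r c y) := by
    have := C.1.finite
    rw [Formula.realize_iExs]
    exact exists_congr fun c => (realize_patternFormula G).trans copyPattern_iff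
  simp only [key, Omits, not_forall, not_not]
  constructor
  · rintro ⟨C, r, c, hinj, h⟩
    exact ⟨C.1, C.2, ⟨⟨⟨place r c, h _ _⟩, hinj⟩⟩⟩
  · rintro ⟨C, hC, ⟨f⟩⟩
    obtain ⟨r, c, hrc⟩ := exists_place (fun x => f x)
    exact ⟨⟨C, hC⟩, r, c, hrc ▸ f.injective, hrc ▸ fun x y hxy => f.toHom.map_adj hxy⟩

/-- The condition on the equality and adjacency types of a tuple which says that it is an
embedding of `A`. -/
def EmbeddingPattern {α : Type*} (A : SimpleGraph α) (e s : α → α → Prop) : Prop :=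
  (∀ i j, e i j → i = j) ∧ ∀ i j, s i j ↔ A.Adj i j

/-- The sentence which says that each embedding of the first part of `A` extends to `A`, unless
the free amalgam contains a member of `𝒞`. -/
noncomputable def extensionSentence (𝒞 : Set FiniteGraph) [Finite 𝒞]
    (A : SimpleGraph (Fin n ⊕ Fin m)) : Language.graph.Sentence :=
  Formula.iAlls (Fin n) <| Formula.relabel (Sum.inr : Fin n → Empty ⊕ Fin n) <|
    (patternFormula (EmbeddingPattern (A.comap Sum.inl))).imp
      (forbiddenFormula 𝒞 A ⊔ (patternFormula (EmbeddingPattern A)).iExs (Fin m))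

theorem realize_extensionSentence {𝒞 : Set FiniteGraph} [Finite 𝒞]
    {A : SimpleGraph (Fin n ⊕ Fin m)} {V : Type*} [Nonempty V] {G : SimpleGraph V} :
    @Sentence.Realize _ V G.structure (extensionSentence 𝒞 A) ↔
      ∀ a : Fin n → V, Function.Injective a →
        (∀ i j, G.Adj (a i) (a j) ↔ A.Adj (.inl i) (.inl j)) → Omits 𝒞 (glue G a A) →
        ∃ b : Fin m → V, Function.Injective (Sum.elim a b) ∧
          ∀ x y, G.Adj (Sum.elim a b x) (Sum.elim a b y) ↔ A.Adj x y := by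
  let := G.structure
  rw [Sentence.Realize, extensionSentence, Formula.realize_iAlls]
  refine forall_congr' fun a => ?_
  rw [Formula.realize_relabel, Formula.realize_imp, Formula.realize_sup, Formula.realize_iExs]
  change (Formula.Realize _ a → Formula.Realize _ a ∨
    ∃ b : Fin m → V, Formula.Realize _ (Sum.elim a b)) ↔ _
  rw [realize_forbiddenFormula, realize_patternFormula]
  simp only [realize_patternFormula]
  constructor
  · intro h hinj hA homits
    obtain ⟨b, hb⟩ := (h ⟨fun i j => @hinj i j, hA⟩).resolve_left (not_not.2 homits)
    exact ⟨b, hb.1, hb.2⟩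
  · rintro h ⟨hinj, hA⟩
    refine or_iff_not_imp_left.2 fun hom => ?_
    obtain ⟨b, hb⟩ := h hinj hA (not_not.1 hom)
    exact ⟨b, hb.1, hb.2⟩

/-- If the free amalgam is `𝒞`-free, it is itself a countable extension of `G` whose new vertices
realize `A` over `a`; existential completeness pulls this back to `G`. -/
theorem extensionSentence_mem (𝒞 : Set FiniteGraph) [Finite 𝒞] (A : SimpleGraph (Fin n ⊕ Fin m)) :
    extensionSentence 𝒞 A ∈ existentiallyCompleteTheory 𝒞 := by
  intro V G hG
  have := hG.countableFree.nonempty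
  have := hG.countableFree.countable
  rw [realize_extensionSentence]
  intro a hinj hA homits
  have h := hG.complete_in (V ⊕ Fin m) (glue G a A) ⟨inferInstance, inferInstance, homits⟩
    (glueInl G a A) n ((patternFormula (EmbeddingPattern A)).iExs (Fin m))
    (isExistential_iExs (isQF_patternFormula _)) a
  rw [@Formula.realize_iExs, @Formula.realize_iExs] at h
  simp only [realize_patternFormula] at h
  have hmap : (Sum.elim (glueInl G a A ∘ a) Sum.inr : Fin n ⊕ Fin m → V ⊕ Fin m) =
      Sum.map a id := by
    ext x : 1
    rcases x with i | i <;> rfl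
  obtain ⟨b, hb⟩ := h ⟨Sum.inr, by
    rw [hmap]
    exact ⟨fun i j h => (hinj.sumMap Function.injective_id) h, glue_adj_iff hinj hA⟩⟩
  exact ⟨b, hb.1, hb.2⟩

end Axioms

/-! ### Models of the theory are the existentially complete graphs -/

section Models

open Language

variable {𝒞 : Set FiniteGraph}

theorem freeTheory_subset (𝒞 : Set FiniteGraph) : freeTheory 𝒞 ⊆ existentiallyCompleteTheory 𝒞 :=
  fun _ hφ V G hG => hφ V G hG.countableFree

/-- Gluing nothing returns `G`, so `forbiddenFormula` also serves to axiomatize `𝒞`-freeness. -/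
theorem omits_glue_empty_iff {V : Type*} {G : SimpleGraph V} {a : Fin 0 → V} :
    Omits 𝒞 (glue G a (⊥ : SimpleGraph (Fin 0 ⊕ Fin 0))) ↔ Omits 𝒞 G := by
  refine ⟨fun h => h.of_embedding (glueInl _ _ _), fun h => h.of_isContained ?_⟩
  exact glue_isContained (b := Fin.elim0) (SimpleGraph.Embedding.refl (G := G))
    (Function.injective_of_subsingleton _) (fun j => j.elim0) (fun _ _ h => h.elim)

/-- The sentence which says that a graph is `𝒞`-free. -/
noncomputable def omitsSentence (𝒞 : Set FiniteGraph) [Finite 𝒞] : Language.graph.Sentence :=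
  Formula.relabel Fin.elim0 (forbiddenFormula 𝒞 (⊥ : SimpleGraph (Fin 0 ⊕ Fin 0))).not

theorem realize_omitsSentence [Finite 𝒞] {V : Type*} [Nonempty V] {G : SimpleGraph V} :
    @Sentence.Realize _ V G.structure (omitsSentence 𝒞) ↔ Omits 𝒞 G := by
  let := G.structure
  rw [Sentence.Realize, omitsSentence, Formula.realize_relabel, Formula.realize_not,
    realize_forbiddenFormula, not_not, omits_glue_empty_iff]

theorem nonempty_of_model {V : Type*} [Language.graph.Structure V]
    (h : Theory.Model V (freeTheory 𝒞)) : Nonempty V := by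
  have : (BoundedFormula.ex ⊤ : Language.graph.Sentence) ∈ freeTheory 𝒞 := by
    intro W G hG
    have := hG.nonempty
    let := G.structure
    exact BoundedFormula.realize_ex.2 ⟨Classical.arbitrary W, BoundedFormula.realize_top.2 trivial⟩
  exact ⟨(BoundedFormula.realize_ex.1 (h.realize_of_mem _ this)).choose⟩

/-- The models of the theory of countable `𝒞`-free graphs are `𝒞`-free graphs. -/
theorem exists_graph_of_model [Finite 𝒞] {V : Type*} [S : Language.graph.Structure V]
    (h : Theory.Model V (freeTheory 𝒞)) : ∃ G : SimpleGraph V, G.structure = S ∧ Omits 𝒞 G := by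
  have := nonempty_of_model h
  have hsub : Theory.simpleGraph ⊆ freeTheory 𝒞 := fun φ hφ W G _ =>
    (simpleGraph_model G).realize_of_mem φ hφ
  have : V ⊨ Theory.simpleGraph := h.mono hsub
  refine ⟨simpleGraphOfStructure V, structure_simpleGraphOfStructure, ?_⟩
  rw [← realize_omitsSentence, structure_simpleGraphOfStructure]
  refine h.realize_of_mem _ fun W G hG => ?_
  have := hG.nonempty
  exact realize_omitsSentence.2 hG.omits

/-- A model of the theory of existentially complete graphs realizes each finite graph over
itself which is realized in a `𝒞`-free extension. -/
theorem exists_partial_embedding [Finite 𝒞] {V : Type*} {G : SimpleGraph V}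
    (hG : @Theory.Model _ V G.structure (existentiallyCompleteTheory 𝒞)) {W : Type*}
    {H : SimpleGraph W} (hH : Omits 𝒞 H) (f : G ↪g H) {s : Set W} (hs : s.Finite) :
    ∃ g : H.induce s ↪g G, ∀ (x : s) v, f v = x → g x = v := by
  have : Nonempty V := @nonempty_of_model 𝒞 V G.structure
    (@Theory.Model.mono _ V G.structure _ _ hG (freeTheory_subset 𝒞))
  have := (hs.inter_of_left (Set.range f)).to_subtype
  have := (hs.sdiff (t := Set.range f)).to_subtype
  obtain ⟨n, ⟨ea⟩⟩ := Finite.exists_equiv_fin ↥(s ∩ Set.range f)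
  obtain ⟨m, ⟨eb⟩⟩ := Finite.exists_equiv_fin ↥(s \ Set.range f)
  choose a ha using fun i : Fin n => (ea.symm i).2.2
  let b : Fin m → W := fun j => eb.symm j
  -- `A` is the graph induced on `s`, split into the vertices `f ∘ a` coming from `G` and the
  -- vertices `b` outside `G`.
  let A : SimpleGraph (Fin n ⊕ Fin m) := H.comap (Sum.elim (f ∘ a) b)
  have hb : Function.Injective b := Subtype.val_injective.comp eb.symm.injective
  have hainj : Function.Injective a := fun i j hij =>
    ea.symm.injective (Subtype.ext ((ha i).symm.trans (hij ▸ ha j)))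
  have hbf : ∀ j v, f v ≠ b j := fun j v hv => (eb.symm j).2.2 ⟨v, hv⟩
  -- The amalgam is a subgraph of the `𝒞`-free graph `H`, so the axiom for `A` supplies a copy `b'`
  -- of `b` inside `G`.
  obtain ⟨b', hinj, hb'⟩ := realize_extensionSentence.1
    (@Theory.Model.realize_of_mem _ V G.structure _ hG _ (extensionSentence_mem 𝒞 A)) a hainj
    (fun i j => f.map_adj_iff.symm)
    (hH.of_isContained (glue_isContained f hb hbf fun _ _ h => h))
  have hcode : ∀ x : s, ∃ i : Fin n ⊕ Fin m, Sum.elim (f ∘ a) b i = x := by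
    rintro ⟨x, hx⟩
    by_cases hxf : x ∈ Set.range f
    · exact ⟨.inl (ea ⟨x, hx, hxf⟩), by simp [ha]⟩
    · exact ⟨.inr (eb ⟨x, hx, hxf⟩), by simp [b]⟩
  choose code hcode using hcode
  refine ⟨⟨⟨fun x => Sum.elim a b' (code x), fun x y hxy => ?_⟩, fun {x y} => ?_⟩, ?_⟩
  · exact Subtype.ext (by rw [← hcode x, ← hcode y, hinj hxy])
  · refine (hb' _ _).trans ?_
    simp [A, hcode]
  · intro x v hv
    have hx := hcode x
    change Sum.elim a b' (code x) = v
    rcases hc : code x with i | j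
    · rw [hc] at hx
      exact f.injective (hx.trans hv.symm)
    · rw [hc] at hx
      exact absurd (hv.trans hx.symm) (hbf j v)

/-- A model of the theory of existentially complete graphs is existentially complete in all its
`𝒞`-free extensions. -/
theorem isExistentiallyCompleteIn_of_model [Finite 𝒞] {V : Type*} {G : SimpleGraph V}
    (hG : @Theory.Model _ V G.structure (existentiallyCompleteTheory 𝒞)) {W : Type*}
    {H : SimpleGraph W} (hH : Omits 𝒞 H) (f : G ↪g H) : IsExistentiallyCompleteIn f := by
  intro n φ hφ v h
  obtain ⟨s, hs, v', xs', hv, -, h'⟩ := exists_finite_realize hφ h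
  obtain ⟨g, hg⟩ := exists_partial_embedding hG hH f hs
  have := realize_of_graphEmbedding hφ g h'
  have hgv : g ∘ v' = v := funext fun i => hg _ _ (hv i).symm
  rw [hgv, Subsingleton.elim (g ∘ xs') default] at this
  exact this

theorem IsExistentiallyComplete.of_iso {V : Type*} {W : Type*} {G : SimpleGraph V}
    {H : SimpleGraph W} (hG : IsExistentiallyComplete 𝒞 G) (e : H ≃g G) :
    IsExistentiallyComplete 𝒞 H where
  countableFree :=
    ⟨e.toEquiv.nonempty_congr.2 hG.1.1, have := hG.1.2; e.toEquiv.countable_iff.2 this,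
      hG.1.3.of_embedding e.toEmbedding⟩
  complete_in K k hK f n φ hφ v h := by
    have := hG.complete_in K k hK (f.comp e.symm.toEmbedding) n φ hφ (e ∘ v)
      (by simpa [Function.comp_def] using h)
    simpa [Function.comp_def] using
      formula_realize_of_graphEmbedding hφ e.symm.toEmbedding this

/-- The theory is defined by graphs in the lowest universe; countability allows `G` to be moved
there. -/
theorem model_of_isExistentiallyComplete {V : Type*} {G : SimpleGraph V}
    (hG : IsExistentiallyComplete 𝒞 G) :
    @Theory.Model _ V G.structure (existentiallyCompleteTheory 𝒞) := by
  have := hG.countableFree.countable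
  let e : G.comap (equivShrink.{0} V).symm ≃g G :=
    ⟨(equivShrink.{0} V).symm, Iff.rfl⟩
  exact @Theory.Model.mk _ V G.structure _ fun φ hφ =>
    (sentence_realize_of_iso e φ).1 (hφ _ _ (hG.of_iso e))

/-- The countable models of the theory of existentially complete graphs are the existentially
complete graphs. -/
theorem exists_isExistentiallyComplete_iff [Finite 𝒞] {V : Type*}
    [S : Language.graph.Structure V] [Countable V] :
    (∃ G : SimpleGraph V, G.structure = S ∧ IsExistentiallyComplete 𝒞 G) ↔
      Theory.Model V (existentiallyCompleteTheory 𝒞) := by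
  constructor
  · rintro ⟨G, rfl, hG⟩
    exact model_of_isExistentiallyComplete hG
  · intro h
    have hfree := h.mono (freeTheory_subset 𝒞)
    have := nonempty_of_model hfree
    obtain ⟨G, rfl, hG⟩ := exists_graph_of_model hfree
    exact ⟨G, rfl, ⟨this, ‹_›, hG⟩, fun W H hH f =>
      isExistentiallyCompleteIn_of_model h hH.omits f⟩

end Models

/-! ### Generic construction of existentially complete graphs -/

section Generic

open Language

variable {𝒞 : Set FiniteGraph}

/-- A finite `𝒞`-free graph whose vertices are natural numbers; the adjacency relation matters
only on `verts`. -/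
structure Condition (𝒞 : Set FiniteGraph) where
  verts : Finset ℕ
  graph : SimpleGraph ℕ
  omits : Omits 𝒞 (graph.induce (verts : Set ℕ))

/-- Conditions are ordered by extension as induced subgraphs. -/
instance : Preorder (Condition 𝒞) where
  le p q := p.verts ⊆ q.verts ∧
    ∀ x ∈ p.verts, ∀ y ∈ p.verts, p.graph.Adj x y ↔ q.graph.Adj x y
  le_refl p := ⟨subset_rfl, fun _ _ _ _ => Iff.rfl⟩
  le_trans p q r hpq hqr := ⟨hpq.1.trans hqr.1, fun x hx y hy =>
    (hpq.2 x hx y hy).trans (hqr.2 x (hpq.1 hx) y (hpq.1 hy))⟩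

/-- The finite graph given by a condition. -/
abbrev Condition.toGraph (p : Condition 𝒞) : SimpleGraph (p.verts : Set ℕ) :=
  p.graph.induce (p.verts : Set ℕ)

/-- The formula `φ` is true in the condition `p`, the parameters `v` being vertices of `p`. -/
def Condition.Solves (p : Condition 𝒞) {n : ℕ} (φ : Language.graph.Formula (Fin n))
    (v : Fin n → ℕ) : Prop :=
  ∃ v' : Fin n → (p.verts : Set ℕ), (∀ i, (v' i : ℕ) = v i) ∧
    @Formula.Realize _ _ p.toGraph.structure _ φ v'

/-- A finite piece of a `𝒞`-free extension of a condition is found in a stronger condition. -/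
theorem Condition.exists_extension (p : Condition 𝒞) {W : Type*} {K : SimpleGraph W}
    (hK : Omits 𝒞 K) (h : p.toGraph ↪g K) {s : Set W} (hs : s.Finite) :
    ∃ q, p ≤ q ∧ ∃ g : K.induce s ↪g q.toGraph,
      ∀ (x : s) (y : (p.verts : Set ℕ)), h y = x → (g x : ℕ) = y := by
  classical
  let t : Set W := s ∪ Set.range h
  have : Finite t := (hs.union (Set.finite_range h)).to_subtype
  obtain ⟨k, ⟨e⟩⟩ := Finite.exists_equiv_fin t
  -- Vertices of `p` keep their labels; the others get labels above all those of `p`.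
  let c : t → ℕ := fun x =>
    if hx : ∃ y, h y = x then hx.choose else p.verts.sup id + 1 + e x
  have hc_old (x : t) (y : (p.verts : Set ℕ)) (hy : h y = x) : c x = y := by
    have hx : ∃ y, h y = x := ⟨y, hy⟩
    simp only [c, dif_pos hx]
    rw [h.injective (hx.choose_spec.trans hy.symm)]
  have hc_new (x : t) (hx : ¬ ∃ y, h y = x) : c x = p.verts.sup id + 1 + e x := by
    simp only [c, dif_neg hx]
  have hlt (y : (p.verts : Set ℕ)) : (y : ℕ) ≤ p.verts.sup id :=
    Finset.le_sup (f := id) y.2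
  have hc : Function.Injective c := by
    intro x x' hxx
    by_cases hx : ∃ y, h y = x <;> by_cases hx' : ∃ y, h y = x'
    · obtain ⟨y, hy⟩ := hx
      obtain ⟨y', hy'⟩ := hx'
      rw [hc_old x y hy, hc_old x' y' hy'] at hxx
      exact Subtype.ext (by rw [← hy, ← hy', Subtype.ext hxx])
    · obtain ⟨y, hy⟩ := hx
      rw [hc_old x y hy, hc_new x' hx'] at hxx
      have := hlt y
      omega
    · obtain ⟨y, hy⟩ := hx'
      rw [hc_old x' y hy, hc_new x hx] at hxx
      have := hlt y
      omega
    · rw [hc_new x hx, hc_new x' hx'] at hxx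
      exact e.injective (Fin.ext (by omega))
  let Q : SimpleGraph ℕ := (K.induce t).map c
  have hQ (x y : t) : Q.Adj (c x) (c y) ↔ K.Adj x y :=
    SimpleGraph.map_adj_apply (G := K.induce t) (f := ⟨c, hc⟩)
  have hfin : (Set.range c).Finite := Set.finite_range c
  have hmem (x : ↥(hfin.toFinset : Set ℕ)) : ∃ y, c y = x := by simpa using x.2
  choose d hd using hmem
  let q : Condition 𝒞 :=
    { verts := hfin.toFinset
      graph := Q
      omits := hK.of_embedding
        { toFun := fun x => d x
          inj' := fun x y hxy => Subtype.ext <| by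
            rw [← hd x, ← hd y, Subtype.ext hxy]
          map_rel_iff' := fun {x y} => by
            change K.Adj (d x) (d y) ↔ Q.Adj x y
            rw [← hQ, hd, hd] } }
  refine ⟨q, ⟨fun x hx => ?_, fun x hx y hy => ?_⟩, ⟨⟨fun x => ⟨c ⟨x, .inl x.2⟩, ?_⟩, ?_⟩, ?_⟩, ?_⟩
  · exact hfin.mem_toFinset.2 ⟨⟨h ⟨x, hx⟩, .inr ⟨_, rfl⟩⟩, hc_old _ ⟨x, hx⟩ rfl⟩
  · have hx' := hc_old ⟨h ⟨x, hx⟩, .inr ⟨_, rfl⟩⟩ ⟨x, hx⟩ rfl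
    have hy' := hc_old ⟨h ⟨y, hy⟩, .inr ⟨_, rfl⟩⟩ ⟨y, hy⟩ rfl
    have := hQ ⟨h ⟨x, hx⟩, .inr ⟨_, rfl⟩⟩ ⟨h ⟨y, hy⟩, .inr ⟨_, rfl⟩⟩
    rw [hx', hy', h.map_adj_iff] at this
    exact this.symm
  · simp [q]
  · intro x y hxy
    exact Subtype.ext (congrArg (fun z : t => (z : W)) (hc (congrArg Subtype.val hxy)))
  · exact hQ _ _
  · exact fun x y hy => hc_old _ _ hy

/-- The conditions which decide whether `φ` is true of `v`. -/
def deciding (𝒞 : Set FiniteGraph)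
    (t : Σ n, Language.graph.Formula (Fin n) × (Fin n → ℕ)) : Order.Cofinal (Condition 𝒞) where
  carrier := {p | p.Solves t.2.1 t.2.2 ∨ ∀ q, p ≤ q → ¬ q.Solves t.2.1 t.2.2}
  isCofinal p := by
    by_cases h : ∃ q, p ≤ q ∧ q.Solves t.2.1 t.2.2
    · obtain ⟨q, hpq, hq⟩ := h
      exact ⟨q, .inl hq, hpq⟩
    · push Not at h
      exact ⟨p, .inr h, le_rfl⟩

/-- The union of an ideal of conditions. -/
def unionGraph (I : Order.Ideal (Condition 𝒞)) : SimpleGraph {x | ∃ p ∈ I, x ∈ p.verts} where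
  Adj x y := ∃ p ∈ I, (x : ℕ) ∈ p.verts ∧ (y : ℕ) ∈ p.verts ∧ p.graph.Adj x y
  symm := ⟨fun _ _ ⟨p, hp, hx, hy, h⟩ => ⟨p, hp, hy, hx, h.symm⟩⟩
  loopless := ⟨fun _ ⟨_, _, _, _, h⟩ => h.ne rfl⟩

/-- Two conditions of the ideal have a common extension, which induces both, so they agree on shared
vertices. -/
theorem unionGraph_adj {I : Order.Ideal (Condition 𝒞)} {p : Condition 𝒞} (hp : p ∈ I)
    {x y : {x | ∃ p ∈ I, x ∈ p.verts}} (hx : (x : ℕ) ∈ p.verts) (hy : (y : ℕ) ∈ p.verts) :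
    (unionGraph I).Adj x y ↔ p.graph.Adj x y := by
  refine ⟨fun ⟨q, hq, hxq, hyq, h⟩ => ?_, fun h => ⟨p, hp, hx, hy, h⟩⟩
  obtain ⟨r, -, hpr, hqr⟩ := I.directed p hp q hq
  exact (hpr.2 _ hx _ hy).2 ((hqr.2 _ hxq _ hyq).1 h)

/-- The members of an ideal of conditions are induced subgraphs of the union. -/
def toUnionGraph {I : Order.Ideal (Condition 𝒞)} {p : Condition 𝒞} (hp : p ∈ I) :
    p.toGraph ↪g unionGraph I where
  toFun x := ⟨x, p, hp, x.2⟩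
  inj' _ _ hxy := Subtype.ext (congrArg (fun z : {x | ∃ p ∈ I, x ∈ p.verts} => (z : ℕ)) hxy)
  map_rel_iff' {x y} := unionGraph_adj hp x.2 y.2

theorem exists_condition_superset (I : Order.Ideal (Condition 𝒞))
    {s : Set {x | ∃ p ∈ I, x ∈ p.verts}} (hs : s.Finite) :
    ∃ p ∈ I, ∀ x ∈ s, (x : ℕ) ∈ p.verts := by
  induction s, hs using Set.Finite.induction_on with
  | empty => exact ⟨_, I.nonempty.choose_spec, by simp⟩
  | @insert x s _ _ ih =>
    obtain ⟨p, hp, hps⟩ := ih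
    obtain ⟨q, hq, hxq⟩ := x.2
    obtain ⟨r, hr, hpr, hqr⟩ := I.directed p hp q hq
    refine ⟨r, hr, ?_⟩
    rintro y (rfl | hy)
    exacts [hqr.1 hxq, hpr.1 (hps y hy)]

theorem omits_unionGraph (I : Order.Ideal (Condition 𝒞)) : Omits 𝒞 (unionGraph I) := by
  refine omits_of_finite fun s hs => ?_
  obtain ⟨p, hp, hps⟩ := exists_condition_superset I hs
  refine p.omits.of_embedding ⟨⟨fun x => ⟨x.1, hps _ x.2⟩, fun x y hxy => ?_⟩, fun {x y} => ?_⟩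
  · exact Subtype.ext (Subtype.ext (congrArg (fun z : (p.verts : Set ℕ) => (z : ℕ)) hxy))
  · exact (unionGraph_adj hp (hps _ x.2) (hps _ y.2)).symm

/-- The union of a generic ideal of conditions is existentially complete. -/
theorem isExistentiallyComplete_unionGraph {I : Order.Ideal (Condition 𝒞)}
    (hne : ∃ p ∈ I, p.verts.Nonempty) (hI : ∀ t, ∃ p, p ∈ deciding 𝒞 t ∧ p ∈ I) :
    IsExistentiallyComplete 𝒞 (unionGraph I) where
  countableFree := by
    refine ⟨?_, inferInstance, omits_unionGraph I⟩
    obtain ⟨p, hp, x, hx⟩ := hne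
    exact ⟨⟨x, p, hp, hx⟩⟩
  complete_in W H hH f n φ hφ v h := by
    obtain ⟨p, hp, hpI⟩ := hI ⟨n, φ, fun i => v i⟩
    obtain ⟨p', hp'I, hv⟩ := exists_condition_superset I (Set.finite_range v)
    obtain ⟨q, hqI, hpq, hp'q⟩ := I.directed p hpI p' hp'I
    obtain ⟨s, hs, v', xs', hv', -, h'⟩ := exists_finite_realize hφ h
    -- `q` extends the deciding condition `p` and contains the parameters. The finite part of `H`
    -- that witnesses `φ` can be absorbed into some `r` above `q`, which need not lie in `I`.
    obtain ⟨r, hqr, g, hg⟩ := q.exists_extension hH.omits (f.comp (toUnionGraph hqI)) hs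
    have hr : r.Solves φ fun i => v i := by
      refine ⟨g ∘ v', fun i => hg _ ⟨v i, hp'q.1 (hv _ ⟨i, rfl⟩)⟩ (hv' i).symm, ?_⟩
      have := realize_of_graphEmbedding hφ g h'
      rwa [Subsingleton.elim (g ∘ xs') default] at this
    -- Since `r` extends `p` and solves `φ`, the negative decision is excluded: `p`, a part of the
    -- union, already solves `φ`.
    obtain ⟨u, hu, h⟩ := hp.resolve_right fun hno => hno r (hpq.trans hqr) hr
    have hw := formula_realize_of_graphEmbedding hφ (toUnionGraph hpI) h
    have huv : toUnionGraph hpI ∘ u = v := funext fun i => Subtype.ext (hu i)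
    rwa [huv] at hw

/-- Each finite `𝒞`-free graph is an induced subgraph of an existentially complete graph. -/
theorem exists_isExistentiallyComplete {W : Type*} [Finite W] [Nonempty W] {K : SimpleGraph W}
    (hK : Omits 𝒞 K) :
    ∃ (V : Type) (G : SimpleGraph V), IsExistentiallyComplete 𝒞 G ∧ Nonempty (K ↪g G) := by
  have hempty : IsEmpty ((∅ : Finset ℕ) : Set ℕ) := by simp
  let h : ((⊥ : SimpleGraph ℕ).induce ((∅ : Finset ℕ) : Set ℕ)) ↪g K :=
    ⟨⟨fun x => isEmptyElim x, fun x => isEmptyElim x⟩, fun {x} => isEmptyElim x⟩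
  -- Extending the empty condition by all of `K` gives a condition that contains a copy of `K`.
  obtain ⟨p, -, g, -⟩ := Condition.exists_extension ⟨∅, ⊥, hK.of_embedding h⟩ hK h
    (Set.finite_univ (α := W))
  let : Encodable (Σ n, Language.graph.Formula (Fin n) × (Fin n → ℕ)) := Encodable.ofCountable _
  let I := Order.idealOfCofinals p (deciding 𝒞)
  have hp : p ∈ I := Order.mem_idealOfCofinals p _
  refine ⟨_, unionGraph I, isExistentiallyComplete_unionGraph ⟨p, hp, ?_⟩
    fun t => Order.cofinal_meets_idealOfCofinals p _ t, ⟨?_⟩⟩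
  · exact ⟨g ⟨Classical.arbitrary W, trivial⟩, (g ⟨Classical.arbitrary W, trivial⟩).2⟩
  · exact ((toUnionGraph hp).comp g).comp (SimpleGraph.induceUnivIso K).symm.toEmbedding

end Generic

/-! ### Ultraproducts, model completeness and the model companion -/

section Ultraproducts

open Language Structure Filter

variable {𝒞 : Set FiniteGraph}

/-- A structure which is approximated on finite sets by maps to structures `E s` embeds in an
ultraproduct of the `E s`. -/
theorem exists_ultraproduct_embedding {N : Type u} [Language.graph.Structure N]
    {E : Finset N → Type w} [∀ s, Language.graph.Structure (E s)] (g : ∀ s, N → E s)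
    (hinj : ∀ s, Set.InjOn (g s) s)
    (hadj : ∀ s, ∀ x ∈ s, ∀ y ∈ s, RelMap adj ![g s x, g s y] ↔ RelMap adj ![x, y]) :
    ∃ (U : Ultrafilter (Finset N)) (f : N ↪[Language.graph] (U : Filter (Finset N)).Product E),
      (∀ x, f x = ((fun s => g s x : ∀ s, E s) : (U : Filter (Finset N)).Product E)) ∧
      ∀ x, ∀ᶠ s in (U : Filter (Finset N)), x ∈ s := by
  -- Refining `atTop` makes each fixed `x` belong to `U`-almost every `s`, where `g s` is faithful
  -- at `x`.
  let U : Ultrafilter (Finset N) := Ultrafilter.of atTop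
  have hmem (x : N) : ∀ᶠ s in (U : Filter (Finset N)), x ∈ s := by
    filter_upwards [Ultrafilter.of_le atTop (eventually_ge_atTop {x})] with s hs
    exact hs (by simp)
  refine ⟨U, ⟨⟨fun x => ((fun s => g s x : ∀ s, E s) : (U : Filter (Finset N)).Product E), ?_⟩,
    fun F => isEmptyElim F, ?_⟩, fun _ => rfl, hmem⟩
  · intro x y hxy
    have h : ∀ᶠ s in (U : Filter (Finset N)), g s x = g s y := Quotient.exact hxy
    obtain ⟨s, hs, hx, hy⟩ := (h.and ((hmem x).and (hmem y))).exists
    exact hinj s hx hy hs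
  · intro n r x
    cases r
    have hrel : RelMap adj (fun i => ((fun s => g s (x i) : ∀ s, E s) :
        (U : Filter (Finset N)).Product E)) ↔
        ∀ᶠ s in (U : Filter (Finset N)), RelMap adj fun i => g s (x i) :=
      relMap_quotient_mk' ((U : Filter (Finset N)).productSetoid E) adj fun i s => g s (x i)
    refine hrel.trans ?_
    have hev : ∀ᶠ s in (U : Filter (Finset N)),
        (RelMap adj (fun i => g s (x i)) ↔ RelMap adj x) := by
      filter_upwards [hmem (x 0), hmem (x 1)] with s h0 h1
      have h := hadj s _ h0 _ h1
      have e1 : (![g s (x 0), g s (x 1)] : Fin 2 → E s) = fun i => g s (x i) := by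
        ext i; fin_cases i <;> rfl
      have e2 : (![x 0, x 1] : Fin 2 → N) = x := by
        ext i; fin_cases i <;> rfl
      rwa [e1, e2] at h
    rw [eventually_congr hev]
    exact eventually_const

/-- Each `𝒞`-free graph embeds in a model of the theory of existentially complete graphs. -/
theorem exists_model_of_omits {N : Type u} [Nonempty N] {H : SimpleGraph N} (hH : Omits 𝒞 H) :
    ∃ (P : Type u) (_ : Language.graph.Structure P), Nonempty P ∧
      Theory.Model P (existentiallyCompleteTheory 𝒞) ∧
      Nonempty (@Language.Embedding Language.graph N P H.structure _) := by
  classical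
  -- Adding `x₀` to every finite set keeps the induced subgraphs nonempty, even for `s = ∅`.
  let x₀ := Classical.arbitrary N
  have hfin (s : Finset N) : ∃ (V : Type) (G : SimpleGraph V), IsExistentiallyComplete 𝒞 G ∧
      Nonempty (H.induce (insert x₀ s : Set N) ↪g G) :=
    haveI : Finite ↥(insert x₀ s : Set N) := (s.finite_toSet.insert x₀).to_subtype
    exists_isExistentiallyComplete (hH.of_embedding (SimpleGraph.Embedding.induce _))
  choose E G hG g using hfin
  replace g := fun s => (g s).some
  let := H.structure
  let (s : Finset N) : Language.graph.Structure (E s) := (G s).structure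
  have (s : Finset N) : Nonempty (E s) := (hG s).countableFree.nonempty
  let g' (s : Finset N) (x : N) : E s :=
    if hx : x ∈ (insert x₀ s : Set N) then g s ⟨x, hx⟩ else Classical.arbitrary _
  have hg' (s : Finset N) (x : N) (hx : x ∈ s) : g' s x = g s ⟨x, .inr hx⟩ :=
    dif_pos (c := x ∈ (insert x₀ s : Set N)) (.inr hx)
  obtain ⟨U, f, -, -⟩ := exists_ultraproduct_embedding g'
    (fun s x hx y hy hxy => by
      rw [hg' s x hx, hg' s y hy] at hxy
      exact congrArg Subtype.val ((g s).injective hxy))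
    (fun s x hx y hy => by
      rw [hg' s x hx, hg' s y hy]
      exact (g s).map_adj_iff)
  refine ⟨_, _, inferInstance, ⟨fun φ hφ => ?_⟩, ⟨f⟩⟩
  rw [Ultraproduct.sentence_realize]
  exact .of_forall fun s => hφ _ _ (hG s)

/-- An extension of a model of the theory of existentially complete graphs embeds over it in an
ultrapower of it. -/
theorem exists_elementary_extension [Finite 𝒞] {M N : Type u} [SM : Language.graph.Structure M]
    [SN : Language.graph.Structure N] (hM : Theory.Model M (existentiallyCompleteTheory 𝒞))
    (hN : Theory.Model N (freeTheory 𝒞)) (f : M ↪[Language.graph] N) :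
    ∃ (P : Type u) (_ : Language.graph.Structure P) (g : N ↪[Language.graph] P)
      (j : M ↪ₑ[Language.graph] P), ∀ x, g (f x) = j x := by
  classical
  have := nonempty_of_model (hM.mono (freeTheory_subset 𝒞))
  obtain ⟨G, rfl, -⟩ := exists_graph_of_model (hM.mono (freeTheory_subset 𝒞))
  obtain ⟨H, rfl, hH⟩ := exists_graph_of_model hN
  let := G.structure
  let := H.structure
  choose g hg using fun s : Finset N =>
    exists_partial_embedding hM hH (graphEmbedding f) s.finite_toSet
  let g' (s : Finset N) (x : N) : M := if hx : x ∈ s then g s ⟨x, hx⟩ else Classical.arbitrary _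
  have hg' (s : Finset N) (x : N) (hx : x ∈ s) : g' s x = g s ⟨x, hx⟩ := dif_pos hx
  obtain ⟨U, k, hk, hmem⟩ := exists_ultraproduct_embedding (E := fun _ => M) g'
    (fun s x hx y hy hxy => by
      rw [hg' s x hx, hg' s y hy] at hxy
      exact congrArg Subtype.val ((g s).injective hxy))
    (fun s x hx y hy => by
      rw [hg' s x hx, hg' s y hy]
      exact (g s).map_adj_iff)
  refine ⟨_, _, k, ⟨fun m => ((fun _ => m : Finset N → M) :
    (U : Filter (Finset N)).Product fun _ => M), fun n φ x => ?_⟩, fun m => ?_⟩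
  · exact (Ultraproduct.realize_formula_cast φ fun i _ => x i).trans eventually_const
  · rw [hk]
    refine Quotient.sound ?_
    -- The partial embeddings fix `M`, so on `M` their limit is the diagonal map.
    change ∀ᶠ s in (U : Filter (Finset N)), g' s (f m) = m
    filter_upwards [hmem (f m)] with s hs
    rw [hg' s _ hs]
    exact hg s _ _ rfl

/-- Only the upward passage of a universal quantifier needs an idea: place `N` over `M` inside an
elementary extension `P` of `M`. The universal statement passes from `M` to `P`, is applied there to
an element of `N`, and the induction hypothesis for `N → P` brings the instance down to `N`; hence
the induction over all pairs of models. -/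
theorem realize_embedding_iff [Finite 𝒞] {α : Type*} {n : ℕ}
    (φ : Language.graph.BoundedFormula α n) {M N : Type u} [Language.graph.Structure M]
    [Language.graph.Structure N] (hM : Theory.Model M (existentiallyCompleteTheory 𝒞))
    (hN : Theory.Model N (existentiallyCompleteTheory 𝒞)) (f : M ↪[Language.graph] N)
    (v : α → M) (xs : Fin n → M) : φ.Realize (f ∘ v) (f ∘ xs) ↔ φ.Realize v xs := by
  induction φ generalizing M N with
  | falsum => rfl
  | equal t₁ t₂ =>
    exact (BoundedFormula.IsAtomic.equal t₁ t₂).isQF.realize_embedding f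
  | rel r ts =>
    exact (BoundedFormula.IsAtomic.rel r ts).isQF.realize_embedding f
  | imp φ ψ ihφ ihψ =>
    rw [BoundedFormula.realize_imp, BoundedFormula.realize_imp, ihφ hM hN, ihψ hM hN]
  | all φ ih =>
    rw [BoundedFormula.realize_all, BoundedFormula.realize_all]
    constructor
    · intro h a
      have := h (f a)
      rwa [← Fin.comp_snoc, ih hM hN] at this
    · intro h b
      obtain ⟨P, _, g, j, hgj⟩ := exists_elementary_extension hM (hN.mono (freeTheory_subset 𝒞)) f
      have hP : Theory.Model P (existentiallyCompleteTheory 𝒞) := (j.theory_model_iff _).1 hM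
      have hall : φ.all.Realize (j ∘ v) (j ∘ xs) :=
        (j.map_boundedFormula φ.all v xs).2 (BoundedFormula.realize_all.2 h)
      have hb := BoundedFormula.realize_all.1 hall (g b)
      have hv : j ∘ v = g ∘ f ∘ v := funext fun i => (hgj _).symm
      have hxs : j ∘ xs = g ∘ f ∘ xs := funext fun i => (hgj _).symm
      rwa [hv, hxs, ← Fin.comp_snoc, ih hN hP] at hb

theorem isModelComplete_existentiallyCompleteTheory [Finite 𝒞] :
    IsModelComplete.{u} (existentiallyCompleteTheory 𝒞) := by
  intro M N _ _ _ _ hM hN f n φ v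
  have := realize_embedding_iff φ hM hN f v default
  rwa [Subsingleton.elim (f ∘ default) default] at this

theorem isModelCompanion_existentiallyCompleteTheory [Finite 𝒞] :
    IsModelCompanion.{u} (existentiallyCompleteTheory 𝒞) (freeTheory 𝒞) where
  modelComplete := isModelComplete_existentiallyCompleteTheory
  embed M S _ hM := by
    obtain ⟨G, rfl, hG⟩ := exists_graph_of_model hM
    exact exists_model_of_omits hG
  embed' M S hne hM := ⟨M, S, hne, hM.mono (freeTheory_subset 𝒞), ⟨Embedding.refl _ _⟩⟩

end Ultraproducts

/-! ### Disjoint unions and completeness -/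

section Completeness

open Language

variable {𝒞 : Set FiniteGraph}

/-- A connected subgraph of a disjoint union lies in one of the two parts. -/
theorem isContained_of_isContained_sum {X V W : Type*} {C : SimpleGraph X} {G : SimpleGraph V}
    {H : SimpleGraph W} (hC : C.Connected) (h : C.IsContained (G ⊕g H)) :
    C.IsContained G ∨ C.IsContained H := by
  obtain ⟨f⟩ := h
  -- No edge joins the two parts, so the side is constant along walks of `C`.
  have hside (x y : X) : (f x).isLeft = (f y).isLeft := by
    obtain ⟨p⟩ := hC.preconnected x y
    induction p with
    | nil => rfl
    | @cons x y z hxy _ ih =>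
      rw [← ih]
      have hadj := f.toHom.map_adj hxy
      change (G ⊕g H).Adj (f x) (f y) at hadj
      rcases hx : f x with a | a <;> rcases hy : f y with b | b <;> simp_all
  obtain ⟨x₀⟩ := hC.nonempty
  have hinj : Function.Injective f := f.injective
  rcases hx₀ : f x₀ with a | a
  · have hl (x : X) : ∃ v, f x = .inl v := Sum.isLeft_iff.1 (by rw [hside x x₀, hx₀]; rfl)
    choose g hg using hl
    refine .inl ⟨⟨⟨g, fun {x y} hxy => ?_⟩, fun x y hxy => hinj ?_⟩⟩
    · have hadj : (G ⊕g H).Adj (f x) (f y) := f.toHom.map_adj hxy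
      rw [hg, hg] at hadj
      simpa using hadj
    · rw [hg, hg]
      exact congrArg _ hxy
  · have hr (x : X) : ∃ v, f x = .inr v :=
      Sum.isRight_iff.1 (Sum.isLeft_eq_false.1 (by rw [hside x x₀, hx₀]; rfl))
    choose g hg using hr
    refine .inr ⟨⟨⟨g, fun {x y} hxy => ?_⟩, fun x y hxy => hinj ?_⟩⟩
    · have hadj : (G ⊕g H).Adj (f x) (f y) := f.toHom.map_adj hxy
      rw [hg, hg] at hadj
      simpa using hadj
    · rw [hg, hg]
      exact congrArg _ hxy

theorem sentence_realize_iff_of_embedding [Finite 𝒞] {M N : Type u}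
    [Language.graph.Structure M] [Language.graph.Structure N]
    (hM : Theory.Model M (existentiallyCompleteTheory 𝒞))
    (hN : Theory.Model N (existentiallyCompleteTheory 𝒞)) (f : M ↪[Language.graph] N)
    (φ : Language.graph.Sentence) : M ⊨ φ ↔ N ⊨ φ := by
  have := realize_embedding_iff φ hM hN f default default
  rw [Subsingleton.elim (f ∘ default) default, Subsingleton.elim (f ∘ default) default] at this
  exact this.symm

theorem isComplete_existentiallyCompleteTheory [Finite 𝒞]
    (h : ∀ C ∈ 𝒞, C.graph.Connected ∧ Nontrivial C.V) :
    (existentiallyCompleteTheory 𝒞).IsComplete := by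
  -- Members of `𝒞` have two vertices, so a single point is `𝒞`-free; this starts the generic
  -- construction and yields consistency.
  have hpoint : Omits 𝒞 (⊥ : SimpleGraph Unit) := by
    rintro C hC ⟨f⟩
    obtain ⟨x, y, hxy⟩ := (h C hC).2
    exact hxy (f.injective rfl)
  obtain ⟨V, G, hG, -⟩ := exists_isExistentiallyComplete hpoint
  let := G.structure
  have := hG.countableFree.nonempty
  have hV := model_of_isExistentiallyComplete hG
  refine ⟨⟨Theory.ModelType.of _ V⟩, fun φ => ?_⟩
  have hequiv (M : Theory.ModelType.{0, 0, 0} (existentiallyCompleteTheory 𝒞)) :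
      M ⊨ φ ↔ V ⊨ φ := by
    obtain ⟨H, hH, hHfree⟩ := exists_graph_of_model (M.is_model.mono (freeTheory_subset 𝒞))
    -- Joint embedding: the disjoint union is `𝒞`-free by connectedness, and a model `P` containing
    -- it agrees with both `M` and `V` on `φ` by model completeness.
    have hsum : Omits 𝒞 (H ⊕g G) := fun C hC hCsum =>
      (isContained_of_isContained_sum (h C hC).1 hCsum).elim (hHfree C hC)
        (hG.countableFree.omits C hC)
    obtain ⟨P, _, _, hP, ⟨f⟩⟩ := exists_model_of_omits hsum
    let := (H ⊕g G).structure
    have hMP : M ⊨ φ ↔ P ⊨ φ := by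
      have e := @Embedding.comp Language.graph M (M ⊕ V) H.structure _ P _ f
        (languageEmbedding SimpleGraph.Embedding.sumInl)
      rw [hH] at e
      exact sentence_realize_iff_of_embedding M.is_model hP e φ
    exact hMP.trans (sentence_realize_iff_of_embedding hV hP
      (f.comp (languageEmbedding SimpleGraph.Embedding.sumInr)) φ).symm
  by_cases hφ : V ⊨ φ
  · exact .inl (Theory.models_sentence_iff.2 fun M => (hequiv M).2 hφ)
  · exact .inr (Theory.models_sentence_iff.2 fun M =>
      (Sentence.realize_not M).2 fun hM => hφ ((hequiv M).1 hM))

end Completeness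

end ForbiddenSubgraphs

theorem theorem1 (𝒞 : Set ForbiddenSubgraphs.FiniteGraph) (h𝒞 : 𝒞.Finite) :
    (∀ (V : Type u) [S : Language.graph.Structure V] [Countable V],
      (∃ G : SimpleGraph V, G.structure = S ∧ ForbiddenSubgraphs.IsExistentiallyComplete 𝒞 G) ↔
        Language.Theory.Model V (ForbiddenSubgraphs.existentiallyCompleteTheory 𝒞)) ∧
    ((∀ C ∈ 𝒞, C.graph.Connected ∧ Nontrivial C.V) →
      (ForbiddenSubgraphs.existentiallyCompleteTheory 𝒞).IsComplete) ∧
    ForbiddenSubgraphs.IsModelComplete.{u} (ForbiddenSubgraphs.existentiallyCompleteTheory 𝒞) ∧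
    ForbiddenSubgraphs.IsModelCompanion.{u} (ForbiddenSubgraphs.existentiallyCompleteTheory 𝒞)
      (ForbiddenSubgraphs.freeTheory 𝒞) := by
  have := h𝒞.to_subtype
  exact ⟨fun V _ _ => ForbiddenSubgraphs.exists_isExistentiallyComplete_iff,
    ForbiddenSubgraphs.isComplete_existentiallyCompleteTheory,
    ForbiddenSubgraphs.isModelComplete_existentiallyCompleteTheory,
    ForbiddenSubgraphs.isModelCompanion_existentiallyCompleteTheory⟩
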